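/- Let $\mathbb{K}$ be any field, and let $n\geq 2$ and $d\geq 1$ be integers. Let $L_{\mathbb{K}}(n)$ be the Leavitt algebra of order $n$, that is, the unital associative $\mathbb{K}$-algebra with generators $x_1,\dots,x_n,y_1,\dots,y_n$ and relations $y_ix_j=\delta_{i,j}1$ for $1\leq i,j\leq n$ and $\sum_{i=1}^n x_iy_i=1$. Let $S=M_d(L_{\mathbb{K}}(n))$ be the algebra of $d\times d$ matrices over it, let $S^-$ denote $S$ viewed as a Lie algebra over $\mathbb{K}$ with bracket $[a,b]=ab-ba$, and let $[S^-,S^-]$ be the Lie subalgebra of $S^-$ consisting of all finite sums of elements $[a,b]$ with $a,b\in S$. A Lie algebra $\mathfrak{L}$ over $\mathbb{K}$ is called simple if $[\mathfrak{L},\mathfrak{L}]\neq\{0\}$ and its only ideals are $\{0\}$ and $\mathfrak{L}$. Then $1_S\notin[S^-,S^-]$ if and only if $[S^-,S^-]$ is a simple Lie algebra. -/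

import Mathlib

/- Every associative ring is viewed as a Lie ring through `⁅a, b⁆ = a * b - b * a`. -/
attribute [local instance] LieRing.ofAssociativeRing

/-- Generators of the Cohn and Leavitt algebras of order `n`: `x i` and `y i` for each of the
`n` indices `i : Fin n`. -/
inductive LeavittGen (n : ℕ) : Type
  | x (i : Fin n) : LeavittGen n
  | y (i : Fin n) : LeavittGen n

/-- The defining relations `y i * x j = δ i j` of the Cohn algebra, in the free associative unital
`K`-algebra on the generators. -/
inductive CohnRel (K : Type*) [Field K] (n : ℕ) :
    FreeAlgebra K (LeavittGen n) → FreeAlgebra K (LeavittGen n) → Prop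
  | yx (i j : Fin n) :
      CohnRel K n (FreeAlgebra.ι K (LeavittGen.y i) * FreeAlgebra.ι K (LeavittGen.x j))
        (if i = j then 1 else 0)

/-- The Cohn `K`-algebra of order `n`: the unital associative `K`-algebra on generators
`x i`, `y i` with relations `y i * x j = δ i j`. -/
abbrev CohnAlgebra (K : Type*) [Field K] (n : ℕ) : Type _ := RingQuot (CohnRel K n)

/-- The generator `x i` of the Cohn algebra. -/
noncomputable def CohnAlgebra.x (K : Type*) [Field K] {n : ℕ} (i : Fin n) : CohnAlgebra K n :=
  RingQuot.mkAlgHom K (CohnRel K n) (FreeAlgebra.ι K (LeavittGen.x i))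

/-- The generator `y i` of the Cohn algebra. -/
noncomputable def CohnAlgebra.y (K : Type*) [Field K] {n : ℕ} (i : Fin n) : CohnAlgebra K n :=
  RingQuot.mkAlgHom K (CohnRel K n) (FreeAlgebra.ι K (LeavittGen.y i))

/-- The relation `1 = ∑ i, x i * y i` in the Cohn algebra. -/
inductive LeavittRel (K : Type*) [Field K] (n : ℕ) : CohnAlgebra K n → CohnAlgebra K n → Prop
  | sum_xy : LeavittRel K n 1 (∑ i : Fin n, CohnAlgebra.x K i * CohnAlgebra.y K i)

/-- The Leavitt `K`-algebra of order `n`: the quotient of the Cohn algebra by the two-sided ideal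
generated by `1 - ∑ i, x i * y i`. -/
abbrev LeavittAlgebra (K : Type*) [Field K] (n : ℕ) : Type _ := RingQuot (LeavittRel K n)

/-- For an associative unital `K`-algebra `S`, the Lie algebra `[S⁻, S⁻]`: the derived ideal of
the Lie algebra `S⁻`, that is, the set of all finite sums of brackets `⁅a, b⁆ = a * b - b * a`
with `a b : S`. -/
abbrev commutatorLie (K S : Type*) [Field K] [Ring S] [Algebra K S] : LieIdeal K S :=
  ⁅(⊤ : LieIdeal K S), (⊤ : LieIdeal K S)⁆

/-! ### Derived Lie algebras of associative algebras -/

section CommutatorLie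

variable (K : Type*) [Field K] {S T : Type*} [Ring S] [Algebra K S] [Ring T] [Algebra K T]

/-! If `1` lies in `[S⁻, S⁻]`, it spans a central ideal, which simplicity forbids. Conversely, `S`
is a simple ring, and a Herstein-type dichotomy (`CentralOrTop`) makes each ideal of `[S⁻, S⁻]`
central or everything. A nonzero central element is invertible in the centre, so lying in `[S⁻, S⁻]`
it would put `1` there. The dichotomy is proved by matrix units for size at least 4 over a simple
ring, in any characteristic (`centralOrTop_matrix`). It applies for every `d ≥ 1` because `L ≅
M_n(L)`, used twice, gives `M_d(L) ≅ M_{dn²}(L)`. Simplicity of `L` follows from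
`exists_mul_mul_eq_one`. -/

theorem commutatorLie_toSubmodule :
    (commutatorLie K S).toSubmodule = Submodule.span K {z : S | ∃ a b, a * b - b * a = z} := by
  rw [commutatorLie, LieSubmodule.lieIdeal_oper_eq_linear_span']
  simp [LieRing.of_associative_ring_bracket]

theorem mem_commutatorLie_iff {z : S} :
    z ∈ commutatorLie K S ↔ z ∈ Submodule.span K {z : S | ∃ a b, a * b - b * a = z} := by
  rw [← commutatorLie_toSubmodule, LieSubmodule.mem_toSubmodule]

theorem commutator_mem_commutatorLie (a b : S) : a * b - b * a ∈ commutatorLie K S :=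
  (mem_commutatorLie_iff K).2 (Submodule.subset_span ⟨a, b, rfl⟩)

theorem map_mem_commutatorLie (f : S →ₐ[K] T) {z : S} (hz : z ∈ commutatorLie K S) :
    f z ∈ commutatorLie K T := by
  rw [mem_commutatorLie_iff] at hz
  induction hz using Submodule.span_induction with
  | mem z h =>
    obtain ⟨a, b, rfl⟩ := h
    simpa using commutator_mem_commutatorLie K (f a) (f b)
  | zero => simp
  | add a b _ _ ha hb => simpa using add_mem ha hb
  | smul c a _ ha => simpa using Submodule.smul_mem (commutatorLie K T).toSubmodule c ha

/-- For central `c`, `c[a, b] = [ca, b]`. -/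
theorem mul_mem_commutatorLie_of_mem_center {c z : S} (hc : c ∈ Subring.center S)
    (hz : z ∈ commutatorLie K S) : c * z ∈ commutatorLie K S := by
  rw [mem_commutatorLie_iff] at hz
  rw [Subring.mem_center_iff] at hc
  induction hz using Submodule.span_induction with
  | mem z h =>
    obtain ⟨a, b, rfl⟩ := h
    convert commutator_mem_commutatorLie K (c * a) b using 1
    rw [mul_sub, mul_assoc, ← mul_assoc b, hc b, mul_assoc]
  | zero => simp
  | add a b _ _ ha hb => simpa [mul_add] using add_mem ha hb
  | smul k a _ ha => simpa using Submodule.smul_mem (commutatorLie K S).toSubmodule k ha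

/-- In a simple ring, a nonzero central sum of commutators makes `1` a sum of commutators. -/
theorem one_mem_commutatorLie_of_mem_center [IsSimpleRing S] {z : S}
    (hz : z ∈ Subring.center S) (hz0 : z ≠ 0) (h : z ∈ commutatorLie K S) :
    (1 : S) ∈ commutatorLie K S := by
  obtain ⟨w, hw⟩ := (IsSimpleRing.isField_center S).mul_inv_cancel
    (a := ⟨z, hz⟩) (by simpa [Subtype.ext_iff] using hz0)
  have h1 := mul_mem_commutatorLie_of_mem_center K w.2 h
  rw [mul_comm] at hw
  have h2 : (w : S) * z = 1 := congrArg Subtype.val hw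
  rwa [h2] at h1

variable (S) in
/-- Every subspace of `[S⁻, S⁻]` stable under bracketing with `[S⁻, S⁻]` is central or everything. -/
def CentralOrTop : Prop :=
  ∀ U : Submodule K S, (∀ u ∈ U, ∀ l ∈ commutatorLie K S, u * l - l * u ∈ U) →
    (∀ u ∈ U, u ∈ Subring.center S) ∨ ∀ l ∈ commutatorLie K S, l ∈ U

variable {K} in
theorem CentralOrTop.of_algEquiv (e : S ≃ₐ[K] T) (h : CentralOrTop K T) : CentralOrTop K S := by
  intro U hU
  obtain h | h := h (U.map e.toLinearMap) (by
    rintro _ ⟨u, hu, rfl⟩ l hl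
    refine ⟨_, hU u hu _ (map_mem_commutatorLie K e.symm.toAlgHom hl), ?_⟩
    simp)
  · left
    intro u hu
    have := h _ ⟨u, hu, rfl⟩
    rw [Subring.mem_center_iff] at this ⊢
    intro g
    apply e.injective
    simpa using this (e g)
  · right
    intro l hl
    obtain ⟨u, hu, hul⟩ := h _ (map_mem_commutatorLie K e.toAlgHom hl)
    have : u = l := e.injective hul
    exact this ▸ hu

variable {K} in
theorem coe_bracket_commutatorLie (a b : commutatorLie K S) :
    ((⁅a, b⁆ : commutatorLie K S) : S) = a * b - b * a := rfl

theorem not_isLieAbelian_commutatorLie {a b : S} (ha : a ∈ commutatorLie K S)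
    (hb : b ∈ commutatorLie K S) (hab : a * b ≠ b * a) : ¬ IsLieAbelian (commutatorLie K S) := by
  intro h
  have := congrArg Subtype.val (h.trivial ⟨a, ha⟩ ⟨b, hb⟩)
  rw [coe_bracket_commutatorLie] at this
  exact hab (sub_eq_zero.1 this)

theorem isSimple_commutatorLie [IsSimpleRing S] (hS : CentralOrTop K S)
    (hna : ¬ IsLieAbelian (commutatorLie K S)) (h1 : (1 : S) ∉ commutatorLie K S) :
    LieAlgebra.IsSimple K (commutatorLie K S) := by
  refine ⟨fun I => ?_, hna⟩
  obtain h | h := hS (I.toSubmodule.map (commutatorLie K S).toSubmodule.subtype) (by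
    rintro _ ⟨(u : commutatorLie K S), hu, rfl⟩ l hl
    exact ⟨⁅u, (⟨l, hl⟩ : commutatorLie K S)⁆, lie_mem_left K _ I _ _ hu, rfl⟩)
  · left
    rw [LieSubmodule.eq_bot_iff]
    intro u hu
    by_contra hu0
    exact h1 (one_mem_commutatorLie_of_mem_center K (h u ⟨u, hu, rfl⟩)
      (fun h => hu0 (Subtype.ext h)) u.2)
  · right
    rw [eq_top_iff]
    intro l _
    obtain ⟨u, hu, hul⟩ := h l l.2
    have : u = l := Subtype.ext hul
    exact this ▸ hu

theorem one_notMem_commutatorLie_of_isSimple [h : LieAlgebra.IsSimple K (commutatorLie K S)] :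
    (1 : S) ∉ commutatorLie K S := by
  intro h1
  set e : commutatorLie K S := ⟨1, h1⟩
  have he : ∀ x : commutatorLie K S, ⁅x, e⁆ = 0 := by
    intro x
    apply Subtype.ext
    rw [coe_bracket_commutatorLie]
    simp [e]
  let I : LieIdeal K (commutatorLie K S) :=
    { Submodule.span K {e} with
      lie_mem := by
        intro x m hm
        obtain ⟨c, rfl⟩ := Submodule.mem_span_singleton.1 hm
        simp [he] }
  have hI : ∀ x ∈ I, ∃ c : K, c • e = x := fun x hx => Submodule.mem_span_singleton.1 hx
  apply h.non_abelian
  obtain hb | ht := h.eq_bot_or_eq_top I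
  · have h0 : e = 0 := by
      have : e ∈ I := Submodule.mem_span_singleton_self e
      rwa [hb, LieSubmodule.mem_bot] at this
    have : Subsingleton S := subsingleton_of_zero_eq_one (congrArg Subtype.val h0).symm
    exact ⟨fun x y => Subtype.ext (Subsingleton.elim _ _)⟩
  · refine ⟨fun x y => ?_⟩
    obtain ⟨c, rfl⟩ := hI y (ht ▸ LieSubmodule.mem_top y)
    simp [he]

end CommutatorLie

/-! ### Lie ideals of matrix algebras over simple rings -/

section MatrixLie

open Matrix

variable {K : Type*} [Field K] {R : Type*} [Ring R] [Algebra K R]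
  {ι : Type*} [Fintype ι] [DecidableEq ι]

theorem single_mem_commutatorLie {i j : ι} (hij : i ≠ j) (r : R) :
    single i j r ∈ commutatorLie K (Matrix ι ι R) := by
  simpa [hij.symm] using commutator_mem_commutatorLie K (single i i (1 : R)) (single i j r)

/-- Brackets of matrix units span `[S⁻, S⁻]`; each is off-diagonal or a combination of differences
`E_ii(rs) - E_jj(sr) = [E_ij(r), E_ji(s)]`. -/
theorem commutatorLie_matrix_le {U : Submodule K (Matrix ι ι R)}
    (hU : ∀ u ∈ U, ∀ l ∈ commutatorLie K (Matrix ι ι R), u * l - l * u ∈ U)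
    (h : ∀ i j : ι, i ≠ j → ∀ r : R, single i j r ∈ U) (hι : 2 ≤ Fintype.card ι) :
    ∀ l ∈ commutatorLie K (Matrix ι ι R), l ∈ U := by
  have hd : ∀ i j : ι, i ≠ j → ∀ r s : R, single i i (r * s) - single j j (s * r) ∈ U := by
    intro i j hij r s
    simpa using hU _ (h i j hij r) _ (single_mem_commutatorLie hij.symm s)
  have hs : ∀ (i j k l : ι) (r s : R),
      single i j r * single k l s - single k l s * single i j r ∈ U := by
    intro i j k l r s
    by_cases hjk : j = k
    · subst hjk
      by_cases hli : l = i
      · subst hli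
        by_cases hjl : j = l
        · subst hjl
          obtain ⟨m, hm⟩ : ∃ m, m ≠ j :=
            have := Fintype.one_lt_card_iff_nontrivial.1 (show 1 < Fintype.card ι by omega)
            exists_ne j
          -- The `E_mm(sr)` terms cancel, leaving `E_jj(rs - sr)`.
          have h1 := hd j m hm.symm r s
          have h2 := hd j m hm.symm 1 (s * r)
          simpa using sub_mem h1 h2
        · simpa using hd l j (Ne.symm hjl) r s
      · simpa [hli] using h i l (Ne.symm hli) (r * s)
    · by_cases hli : l = i
      · subst hli
        simpa [hjk] using neg_mem (h k j (Ne.symm hjk) (s * r))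
      · simp [hjk, hli]
  intro z hz
  rw [mem_commutatorLie_iff] at hz
  refine Submodule.span_le.2 ?_ hz
  rintro _ ⟨a, b, rfl⟩
  change a * b - b * a ∈ U
  induction a using Matrix.induction_on' with
  | h_zero => simp
  | h_add p q hp hq => convert add_mem hp hq using 1; noncomm_ring
  | h_std_basis i j r =>
    induction b using Matrix.induction_on' with
    | h_zero => simp
    | h_add p q hp hq => convert add_mem hp hq using 1; noncomm_ring
    | h_std_basis k l s => exact hs i j k l r s

/-- Bracketing with off-diagonal units moves an entry to any off-diagonal position and multiplies it
on either side, so the entries available at all such positions form a two-sided ideal. -/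
theorem single_mem_of_single_mem [IsSimpleRing R] {U : Submodule K (Matrix ι ι R)}
    (hU : ∀ u ∈ U, ∀ l ∈ commutatorLie K (Matrix ι ι R), u * l - l * u ∈ U)
    (hι : 3 ≤ Fintype.card ι) {i j : ι} {r : R} (hr : r ≠ 0)
    (h : single i j r ∈ U) : ∀ k l : ι, k ≠ l → ∀ s : R, single k l s ∈ U := by
  have third : ∀ i j : ι, ∃ k, k ≠ i ∧ k ≠ j := by
    intro i j
    obtain ⟨k, -, hk⟩ := Finset.exists_mem_notMem_of_card_lt_card
      (s := {i, j}) (t := (Finset.univ : Finset ι))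
      (Finset.card_le_two.trans_lt (by rw [Finset.card_univ]; omega))
    simp only [Finset.mem_insert, Finset.mem_singleton, not_or] at hk
    exact ⟨k, hk⟩
  have right : ∀ {i j l : ι} {r : R} (s : R), j ≠ l → i ≠ l → single i j r ∈ U →
      single i l (r * s) ∈ U := by
    intro i j l r s hjl hil h
    simpa [hil.symm] using hU _ h _ (single_mem_commutatorLie hjl s)
  have left : ∀ {i j k : ι} {r : R} (s : R), k ≠ i → k ≠ j → single i j r ∈ U →
      single k j (s * r) ∈ U := by
    intro i j k r s hki hkj h
    simpa [hkj.symm] using neg_mem (hU _ h _ (single_mem_commutatorLie hki s))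
  have col : ∀ {i j l : ι} {r : R}, i ≠ l → single i j r ∈ U → single i l r ∈ U := by
    intro i j l r hil h
    by_cases hjl : j = l
    · exact hjl ▸ h
    · simpa using right 1 hjl hil h
  have row : ∀ {i j k : ι} {r : R}, k ≠ j → single i j r ∈ U → single k j r ∈ U := by
    intro i j k r hkj h
    by_cases hki : k = i
    · exact hki ▸ h
    · simpa using left 1 hki hkj h
  have all : ∀ {i j : ι} {r : R}, single i j r ∈ U → ∀ k l, k ≠ l →
      single k l r ∈ U := by
    intro i j r h k l hkl
    -- The route `(i,j) → (i,m) → (k,m) → (k,l)` moves only to off-diagonal positions.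
    obtain ⟨m, hmi, hmk⟩ := third i k
    exact col hkl (row hmk.symm (col hmi.symm h))
  let J : TwoSidedIdeal R := .mk' {r | ∀ k l : ι, k ≠ l → single k l r ∈ U}
    (by simp)
    (by intro x y hx hy k l hkl; rw [single_add]; exact add_mem (hx k l hkl) (hy k l hkl))
    (by intro x hx k l hkl; have := neg_mem (hx k l hkl); rwa [single_neg] at this)
    (by
      intro x y hy k l hkl
      obtain ⟨m, hmk, hml⟩ := third k l
      exact left x hmk.symm hkl (hy m l hml))
    (by
      intro x y hx k l hkl
      obtain ⟨m, hmk, hml⟩ := third k l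
      exact right y hml hkl (hx k m hmk.symm))
  have hJ : ∀ x, x ∈ J ↔ ∀ k l : ι, k ≠ l → single k l x ∈ U := fun x => by
    simp only [J, TwoSidedIdeal.mem_mk', Set.mem_ofPred_eq]
  have h1 : (1 : R) ∈ J :=
    IsSimpleRing.one_mem_of_ne_zero_mem J hr ((hJ r).2 (all h))
  intro k l hkl s
  have := (hJ _).1 (J.mul_mem_left s 1 h1) k l hkl
  simpa using this

/-- Unless `U` contains `[S⁻, S⁻]`, it has no nonzero off-diagonal unit `E_ij(r)`. Brackets
isolating one entry of `u ∈ U` then force `u` to be a central scalar matrix. -/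
theorem centralOrTop_matrix [IsSimpleRing R] (hι : 4 ≤ Fintype.card ι) :
    CentralOrTop K (Matrix ι ι R) := by
  intro U hU
  by_contra! hcon
  obtain ⟨⟨u, hu, huc⟩, l, hl, hlU⟩ := hcon
  have key : ∀ {i j : ι} {r : R}, i ≠ j → single i j r ∈ U → r = 0 := by
    intro i j r hij h
    by_contra hr
    exact hlU (commutatorLie_matrix_le hU
      (single_mem_of_single_mem hU (by omega) hr h) (by omega) l hl)
  have off : ∀ i k : ι, i ≠ k → u i k = 0 := by
    intro i k hik
    -- Size 4 supplies two spare indices, with which `[[[u, E_ji], E_kl], E_li] = E_ji(-u_ik)`.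
    obtain ⟨j, l, hj, hl, hjl⟩ : ∃ j l : ι, j ∉ ({i, k} : Finset ι) ∧ l ∉ ({i, k} : Finset ι) ∧
        j ≠ l := by
      have hc : 1 < (({i, k} : Finset ι)ᶜ).card := by
        rw [Finset.card_compl]
        have := Finset.card_le_two (a := i) (b := k)
        omega
      obtain ⟨j, hj, l, hl, hjl⟩ := Finset.one_lt_card.1 hc
      exact ⟨j, l, by simpa using hj, by simpa using hl, hjl⟩
    simp only [Finset.mem_insert, Finset.mem_singleton, not_or, ← ne_eq] at hj hl
    obtain ⟨hji, hjk⟩ := hj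
    obtain ⟨hli, hlk⟩ := hl
    have h1 := hU _ (hU _ (hU _ hu _ (single_mem_commutatorLie hji (1 : R))) _
      (single_mem_commutatorLie hlk.symm (1 : R))) _ (single_mem_commutatorLie hli (1 : R))
    have h2 : ((u * single j i 1 - single j i 1 * u) * single k l 1 -
        single k l 1 * (u * single j i 1 - single j i 1 * u)) * single l i 1 -
        single l i 1 * ((u * single j i 1 - single j i 1 * u) * single k l 1 -
        single k l 1 * (u * single j i 1 - single j i 1 * u)) = single j i (-u i k) := by
      simp only [sub_mul, mul_sub, ← mul_assoc, single_mul_mul_single]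
      simp [mul_assoc, hik, hjl.symm, hji.symm, hli.symm, ← single_neg]
    rw [h2] at h1
    simpa using key hji h1
  have diag : ∀ i j : ι, i ≠ j → ∀ r : R, u i i * r = r * u j j := by
    intro i j hij r
    have h1 := hU _ hu _ (single_mem_commutatorLie hij r)
    have h2 : u * single i j r - single i j r * u = single i j (u i i * r - r * u j j) := by
      ext p q
      by_cases hp : p = i <;> by_cases hq : q = j
      · subst hp hq; simp
      · subst hp; simp [hq, single_apply_of_col_ne _ _ (Ne.symm hq), off j q (Ne.symm hq)]
      · subst hq; simp [hp, single_apply_of_row_ne (Ne.symm hp), off p i hp]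
      · simp [hp, hq, single_apply_of_row_ne (Ne.symm hp)]
    rw [h2] at h1
    exact sub_eq_zero.1 (key hij h1)
  have eq : ∀ i j : ι, u i i = u j j := by
    intro i j
    by_cases hij : i = j
    · rw [hij]
    · simpa using diag i j hij 1
  apply huc
  rw [Subring.mem_center_iff]
  intro g
  have hud : u = diagonal fun i => u i i := by
    ext p q
    by_cases hpq : p = q
    · subst hpq; simp
    · simp [hpq, off p q hpq]
  have := Fintype.one_lt_card_iff_nontrivial.1 (show 1 < Fintype.card ι by omega)
  rw [hud]
  ext p q
  rw [mul_diagonal, diagonal_mul]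
  obtain ⟨m, hm⟩ := exists_ne q
  rw [eq p m, diag m q hm]

theorem not_isLieAbelian_commutatorLie_matrix [Nontrivial R] (hι : 3 ≤ Fintype.card ι) :
    ¬ IsLieAbelian (commutatorLie K (Matrix ι ι R)) := by
  obtain ⟨i, j, k, hij, hik, hjk⟩ := Fintype.two_lt_card_iff.1 hι
  refine not_isLieAbelian_commutatorLie K (single_mem_commutatorLie hij (1 : R))
    (single_mem_commutatorLie hjk (1 : R)) fun h => ?_
  have := congrFun (congrFun h i) k
  simp [hik.symm] at this

end MatrixLie

/-! ### Simplicity of the Leavitt algebra -/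

section LeavittFamily

variable {K A : Type*} [Field K] [Ring A] [Algebra K A] {n : ℕ}

variable (K) in
/-- Elements `x i`, `y i` that generate `A` and satisfy the Leavitt relations. -/
structure IsLeavittFamily (x y : Fin n → A) : Prop where
  yx_same (i : Fin n) : y i * x i = 1
  yx_of_ne {i j : Fin n} (hij : i ≠ j) : y i * x j = 0
  sum_xy : ∑ i, x i * y i = 1
  adjoin_eq_top : Algebra.adjoin K (Set.range x ∪ Set.range y) = ⊤

/-- The product of the elements `x i` along a word. -/
def xWord (x : Fin n → A) (l : List (Fin n)) : A := (l.map x).prod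

/-- The product of the elements `y i` along a reversed word. -/
def yWord (y : Fin n → A) (l : List (Fin n)) : A := (l.reverse.map y).prod

@[simp] theorem xWord_nil (x : Fin n → A) : xWord x [] = 1 := rfl

@[simp] theorem xWord_cons (x : Fin n → A) (i : Fin n) (l : List (Fin n)) :
    xWord x (i :: l) = x i * xWord x l := by simp [xWord]

theorem xWord_append (x : Fin n → A) (l m : List (Fin n)) :
    xWord x (l ++ m) = xWord x l * xWord x m := by simp [xWord]

@[simp] theorem yWord_nil (y : Fin n → A) : yWord y [] = 1 := rfl

@[simp] theorem yWord_cons (y : Fin n → A) (i : Fin n) (l : List (Fin n)) :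
    yWord y (i :: l) = yWord y l * y i := by simp [yWord]

namespace IsLeavittFamily

variable {x y : Fin n → A} (h : IsLeavittFamily K x y)
include h

theorem yWord_mul_xWord_append (l m : List (Fin n)) :
    yWord y l * xWord x (l ++ m) = xWord x m := by
  induction l with
  | nil => simp
  | cons i l ih =>
    rw [yWord_cons, List.cons_append, xWord_cons, mul_assoc, ← mul_assoc (y i), h.yx_same, one_mul,
      ih]

theorem yWord_mul_xWord_eq_zero {l m : List (Fin n)} (hlen : l.length ≤ m.length)
    (hlm : ¬ l <+: m) : yWord y l * xWord x m = 0 := by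
  induction l generalizing m with
  | nil => simp at hlm
  | cons i l ih =>
    cases m with
    | nil => simp at hlen
    | cons j m =>
      rw [yWord_cons, xWord_cons, mul_assoc, ← mul_assoc (y i)]
      by_cases hij : i = j
      · subst hij
        rw [h.yx_same, one_mul]
        exact ih (by simpa using hlen) (by simpa using hlm)
      · rw [h.yx_of_ne hij, zero_mul, mul_zero]

/-- Right multiplication by long words in the `x i` carries every element into the span of words in
the `x i`, and shortens words by a bounded amount only. -/
theorem exists_mul_xWord_mem_span (a : A) : ∃ N : ℕ, ∀ l : List (Fin n), N ≤ l.length →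
    a * xWord x l ∈ Submodule.span K (xWord x '' {m | l.length ≤ m.length + N}) := by
  have ha : a ∈ Algebra.adjoin K (Set.range x ∪ Set.range y) := h.adjoin_eq_top ▸ Algebra.mem_top
  induction ha using Algebra.adjoin_induction with
  | mem a ha =>
    obtain ⟨i, rfl⟩ | ⟨i, rfl⟩ := ha
    · refine ⟨0, fun l _ => Submodule.subset_span ⟨i :: l, ?_, by simp⟩⟩
      simp
    · refine ⟨1, fun l hl => ?_⟩
      cases l with
      | nil => simp at hl
      | cons j l =>
        rw [xWord_cons, ← mul_assoc]
        by_cases hij : i = j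
        · subst hij
          rw [h.yx_same, one_mul]
          exact Submodule.subset_span ⟨l, by simp, rfl⟩
        · rw [h.yx_of_ne hij, zero_mul]
          exact zero_mem _
  | algebraMap c =>
    refine ⟨0, fun l _ => ?_⟩
    rw [← Algebra.smul_def]
    exact Submodule.smul_mem _ _ (Submodule.subset_span ⟨l, by simp, rfl⟩)
  | add a b _ _ ha hb =>
    obtain ⟨M, hM⟩ := ha
    obtain ⟨N, hN⟩ := hb
    refine ⟨M + N, fun l hl => ?_⟩
    rw [add_mul]
    refine add_mem (Submodule.span_mono (Set.image_mono ?_) (hM l (by omega)))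
      (Submodule.span_mono (Set.image_mono ?_) (hN l (by omega))) <;>
    · intro m hm
      simp only [Set.mem_ofPred_eq] at hm ⊢
      omega
  | mul a b _ _ ha hb =>
    obtain ⟨M, hM⟩ := ha
    obtain ⟨N, hN⟩ := hb
    -- Multiplying by `b` costs at most `N` letters, so at least `M` remain for `a`.
    refine ⟨M + N, fun l hl => ?_⟩
    rw [mul_assoc]
    have hb := hN l (by omega)
    generalize b * xWord x l = z at hb
    induction hb using Submodule.span_induction with
    | mem c hc =>
      obtain ⟨m, hm, rfl⟩ := hc
      simp only [Set.mem_ofPred_eq] at hm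
      refine Submodule.span_mono (Set.image_mono ?_) (hM m (by omega))
      intro k hk
      simp only [Set.mem_ofPred_eq] at hk ⊢
      omega
    | zero => simp
    | add c d _ _ hc hd => rw [mul_add]; exact add_mem hc hd
    | smul k c _ hc => rw [mul_smul_comm]; exact Submodule.smul_mem _ _ hc

theorem exists_mul_xWord_ne_zero {a : A} (ha : a ≠ 0) (N : ℕ) :
    ∃ l : List (Fin n), l.length = N ∧ a * xWord x l ≠ 0 := by
  induction N generalizing a with
  | zero => exact ⟨[], by simpa using ha⟩
  | succ N ih =>
    obtain ⟨i, hi⟩ : ∃ i, a * x i ≠ 0 := by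
      by_contra! hc
      apply ha
      rw [← mul_one a, ← h.sum_xy, Finset.mul_sum]
      exact Finset.sum_eq_zero fun i _ => by rw [← mul_assoc, hc, zero_mul]
    obtain ⟨l, hl, hne⟩ := ih hi
    exact ⟨i :: l, by simp [hl], by simpa [mul_assoc] using hne⟩

/-- Write some nonzero `a * xWord x l` as a combination of words, and let `s` be a shortest one.
Left multiplication by `yWord y s` sends `s` to `1`, `s ++ δ` to `δ`, and other words to `0`.
Conjugation by `μ` then kills each nonempty `δ`. Linear independence of words is not needed. -/
theorem exists_mul_mul_eq_one (hn : 2 ≤ n) {a : A} (ha : a ≠ 0) : ∃ p q : A, p * a * q = 1 := by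
  classical
  obtain ⟨N, hN⟩ := h.exists_mul_xWord_mem_span a
  obtain ⟨l, hl, hne⟩ := h.exists_mul_xWord_ne_zero ha N
  have hspan := Submodule.span_mono (Set.image_subset_range _ _) (hN l hl.ge)
  obtain ⟨f, hf⟩ := (Finsupp.mem_span_range_iff_exists_finsupp).1 hspan
  have hf0 : f.support.Nonempty := by
    rw [Finsupp.support_nonempty_iff]
    rintro rfl
    exact hne (by simpa using hf.symm)
  obtain ⟨s, hs, hmin⟩ := f.support.exists_min_image List.length hf0
  let M := f.support.sup List.length
  -- For `0 < |δ| ≤ M`, position `M` holds `1` in `μ` but `0` in `δ ++ μ`, so `μ` is not a prefix of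
  -- `δ ++ μ`.
  let μ : List (Fin n) := List.replicate M ⟨0, by omega⟩ ++ [⟨1, by omega⟩]
  have hterm : ∀ t ∈ f.support, t ≠ s → yWord y μ * (yWord y s * xWord x t) * xWord x μ = 0 := by
    intro t ht hts
    by_cases hst : s <+: t
    · obtain ⟨δ, rfl⟩ := hst
      have hδ : 0 < δ.length := by
        rw [List.length_pos_iff]
        rintro rfl
        simp at hts
      have hδM : δ.length ≤ M := by
        have := Finset.le_sup (f := List.length) ht
        rw [List.length_append] at this
        omega
      rw [h.yWord_mul_xWord_append, mul_assoc, ← xWord_append]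
      refine h.yWord_mul_xWord_eq_zero (by simp) fun hp => ?_
      have h1 : μ[M]? = some ⟨1, by omega⟩ := by simp [μ]
      have h2 : (δ ++ μ)[M]? = some ⟨0, by omega⟩ := by
        rw [List.getElem?_append_right hδM]
        simp only [μ]
        rw [List.getElem?_append_left (by simp; omega), List.getElem?_replicate, if_pos (by omega)]
      obtain ⟨ε, hε⟩ := hp
      rw [← hε, List.getElem?_append_left (by simp [μ]), h1] at h2
      simp at h2
    · rw [h.yWord_mul_xWord_eq_zero (hmin t ht) hst]
      simp
  have hsum : yWord y μ * (yWord y s * (a * xWord x l)) * xWord x μ = f s • 1 := by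
    rw [← hf, Finsupp.sum, Finset.mul_sum, Finset.mul_sum, Finset.sum_mul,
      Finset.sum_eq_single s]
    · have h1 := h.yWord_mul_xWord_append s []
      have h2 := h.yWord_mul_xWord_append μ []
      simp only [List.append_nil, xWord_nil] at h1 h2
      simp [h1, h2]
    · intro t ht hts
      have := hterm t ht hts
      rw [mul_smul_comm, mul_smul_comm, smul_mul_assoc, this, smul_zero]
    · intro hs'
      exact absurd hs hs'
  refine ⟨(f s)⁻¹ • (yWord y μ * yWord y s), xWord x l * xWord x μ, ?_⟩
  rw [smul_mul_assoc, smul_mul_assoc]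
  simp only [mul_assoc] at hsum ⊢
  rw [hsum, smul_smul, inv_mul_cancel₀ (Finsupp.mem_support_iff.1 hs), one_smul]

theorem isSimpleRing [Nontrivial A] (hn : 2 ≤ n) : IsSimpleRing A := by
  refine .of_eq_bot_or_eq_top fun I => ?_
  by_cases hI : I = ⊥
  · exact .inl hI
  · right
    obtain ⟨a, haI, ha⟩ : ∃ a ∈ I, a ≠ 0 := by
      by_contra! hc
      apply hI
      rw [eq_bot_iff]
      intro a ha
      rw [TwoSidedIdeal.mem_bot]
      exact hc a ha
    obtain ⟨p, q, hpq⟩ := h.exists_mul_mul_eq_one hn ha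
    rw [← TwoSidedIdeal.one_mem_iff, ← hpq]
    exact I.mul_mem_right _ _ (I.mul_mem_left _ _ haI)

omit h in
/-- The Leavitt relations identify `A` with the matrix algebra of size `n` over `A`. -/
noncomputable def matrixAlgEquiv (h : IsLeavittFamily K x y) : A ≃ₐ[K] Matrix (Fin n) (Fin n) A :=
  AlgEquiv.ofLinearEquiv
    { toFun := fun a => Matrix.of fun i j => y i * a * x j
      map_add' := by intro a b; ext i j; simp [mul_add, add_mul]
      map_smul' := by intro c a; ext i j; simp
      invFun := fun M => ∑ i, ∑ j, x i * M i j * y j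
      left_inv := by
        intro a
        have : ∀ i j, x i * (y i * a * x j) * y j = x i * y i * a * (x j * y j) := by
          intro i j; noncomm_ring
        simp only [Matrix.of_apply, this, ← Finset.mul_sum, h.sum_xy, mul_one, ← Finset.sum_mul,
          one_mul]
      right_inv := by
        intro M
        ext k l
        simp only [Matrix.of_apply, Finset.mul_sum, Finset.sum_mul]
        rw [Finset.sum_eq_single k, Finset.sum_eq_single l]
        · rw [mul_assoc, mul_assoc (x k * M k l), h.yx_same, mul_one, ← mul_assoc, h.yx_same,
            one_mul]
        · intro j _ hj
          rw [mul_assoc, mul_assoc (x k * M k j), h.yx_of_ne hj, mul_zero, mul_zero]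
        · simp
        · intro i _ hi
          refine Finset.sum_eq_zero fun j _ => ?_
          rw [mul_assoc (x i), ← mul_assoc (y k), h.yx_of_ne hi.symm, zero_mul, zero_mul]
        · simp }
    (by
      ext i j
      by_cases hij : i = j
      · subst hij; simp [h.yx_same]
      · simp [h.yx_of_ne hij, hij])
    (by
      intro a b
      ext i j
      have : ∀ k, y i * a * x k * (y k * b * x j) = y i * a * (x k * y k) * (b * x j) := by
        intro k; noncomm_ring
      simp only [LinearEquiv.coe_mk, LinearMap.coe_mk, AddHom.coe_mk, Matrix.of_apply,
        Matrix.mul_apply, this, ← Finset.sum_mul, ← Finset.mul_sum, h.sum_xy]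
      noncomm_ring)

theorem isSimple_commutatorLie_matrix (hn : 2 ≤ n) {ι : Type*} [Fintype ι] [DecidableEq ι]
    [Nonempty ι] (h1 : (1 : Matrix ι ι A) ∉ commutatorLie K (Matrix ι ι A)) :
    LieAlgebra.IsSimple K (commutatorLie K (Matrix ι ι A)) := by
  -- Over the zero ring `1 = 0` would lie in the commutator ideal.
  have : Nontrivial A := by
    by_contra hc
    rw [not_nontrivial_iff_subsingleton] at hc
    exact h1 (Subsingleton.elim (0 : Matrix ι ι A) 1 ▸ zero_mem _)
  have := h.isSimpleRing hn
  -- A single expansion would guarantee only size 2; two guarantee 4.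
  let e : Matrix ι ι A ≃ₐ[K] Matrix (ι × Fin n × Fin n) (ι × Fin n × Fin n) A :=
    (h.matrixAlgEquiv.trans (h.matrixAlgEquiv.mapMatrix.trans
      (Matrix.compAlgEquiv _ _ _ K))).mapMatrix.trans (Matrix.compAlgEquiv _ _ _ K)
  have hcard : 4 ≤ Fintype.card (ι × Fin n × Fin n) := by
    simp only [Fintype.card_prod, Fintype.card_fin]
    have := Fintype.card_pos (α := ι)
    nlinarith
  have hna := not_isLieAbelian_commutatorLie_matrix (K := K) (R := A)
    (show 3 ≤ Fintype.card (ι × Fin n × Fin n) by omega)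
  refine isSimple_commutatorLie K ((centralOrTop_matrix hcard).of_algEquiv e) (fun hab => hna ?_) h1
  refine ⟨fun a b => Subtype.ext ?_⟩
  have := congrArg Subtype.val (hab.trivial ⟨_, map_mem_commutatorLie K e.symm.toAlgHom a.2⟩
    ⟨_, map_mem_commutatorLie K e.symm.toAlgHom b.2⟩)
  rw [coe_bracket_commutatorLie] at this ⊢
  apply e.symm.injective
  simpa using this

end IsLeavittFamily

end LeavittFamily

/-! ### The Leavitt relations in the presented algebra -/

section Leavitt

variable (K : Type*) [Field K] (n : ℕ)

theorem LeavittAlgebra.isLeavittFamily : IsLeavittFamily K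
    (fun i : Fin n => RingQuot.mkAlgHom K (LeavittRel K n) (CohnAlgebra.x K i))
    (fun i : Fin n => RingQuot.mkAlgHom K (LeavittRel K n) (CohnAlgebra.y K i)) where
  yx_same i := by
    rw [← map_mul, CohnAlgebra.x, CohnAlgebra.y, ← map_mul,
      RingQuot.mkAlgHom_rel K (CohnRel.yx i i), if_pos rfl, map_one, map_one]
  yx_of_ne {i j} hij := by
    rw [← map_mul, CohnAlgebra.x, CohnAlgebra.y, ← map_mul,
      RingQuot.mkAlgHom_rel K (CohnRel.yx i j), if_neg hij, map_zero, map_zero]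
  sum_xy := by
    simp only [← map_mul, ← map_sum]
    rw [← RingQuot.mkAlgHom_rel K LeavittRel.sum_xy, map_one]
  adjoin_eq_top := by
    let φ : FreeAlgebra K (LeavittGen n) →ₐ[K] LeavittAlgebra K n :=
      (RingQuot.mkAlgHom K (LeavittRel K n)).comp (RingQuot.mkAlgHom K (CohnRel K n))
    have hφ : Function.Surjective φ :=
      (RingQuot.mkAlgHom_surjective K _).comp (RingQuot.mkAlgHom_surjective K _)
    rw [eq_top_iff, ← (AlgHom.range_eq_top φ).2 hφ, ← Algebra.map_top,
      ← FreeAlgebra.adjoin_range_ι, AlgHom.map_adjoin]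
    apply Algebra.adjoin_mono
    rintro _ ⟨_, ⟨g, rfl⟩, rfl⟩
    cases g with
    | x i => exact .inl ⟨i, rfl⟩
    | y i => exact .inr ⟨i, rfl⟩

end Leavitt

theorem proposition3p3 (K : Type*) [Field K] (n d : ℕ) (hn : 2 ≤ n) (hd : 1 ≤ d) :
    (1 : Matrix (Fin d) (Fin d) (LeavittAlgebra K n)) ∉
        commutatorLie K (Matrix (Fin d) (Fin d) (LeavittAlgebra K n)) ↔
      LieAlgebra.IsSimple K
        (commutatorLie K (Matrix (Fin d) (Fin d) (LeavittAlgebra K n))) :=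
  have : Nonempty (Fin d) := ⟨⟨0, hd⟩⟩
  ⟨(LeavittAlgebra.isLeavittFamily K n).isSimple_commutatorLie_matrix hn,
    fun _ => one_notMem_commutatorLie_of_isSimple K⟩
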